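/- Rings are associative, not necessarily commutative. For a unital ring $R$ and $a\in R$, let $\langle a\rangle_1$ be the subring of $R$ generated by $1$ and $a$, put $a\sim_1 b$ if $\langle a\rangle_1=\langle b\rangle_1$, and let $[a]_1$ be the class of $a$. The unital compressed commuting graph $\Lambda^1(R)$ is the undirected graph (loops allowed) whose vertex set $V(\Lambda^1(R))$ is the set of all classes $[a]_1$, $a\in R$, where $[a]_1$ and $[b]_1$ are adjacent if and only if $ab=ba$. For a unital ring $Z$, a (two-sided) $Z$-ring is a possibly nonunital ring $I$ that is also a $Z$-bimodule (where $1_Z$ is not required to act as the identity on $I$ from either side) such that $z\cdot(xy)=(z\cdot x)y$, $x(z\cdot y)=(x\cdot z)y$ and $(xy)\cdot z=x(y\cdot z)$ for all $z\in Z$ and $x,y\in I$. The semidirect product $Z\ltimes I$ is the ring on $Z\times I$ with componentwise addition and multiplication $(z_1,x_1)(z_2,x_2)=(z_1z_2,\; z_1\cdot x_2+x_1\cdot z_2+x_1x_2)$. It is called a unital semidirect product if $I$ contains an idempotent $e$ such that $1_Z\cdot x=x-ex$ and $x\cdot 1_Z=x-xe$ for all $x\in I$; then $(1_Z,e)$ is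 its identity element. **Theorem.** Let $R$ be an infinite unital ring. Then either $|V(\Lambda^1(R))|=|R|$, or $R$ is isomorphic to a unital semidirect product $\mathbb{Z}[\frac1m]\ltimes I$ for some positive integer $m$ and some finite $\mathbb{Z}[\frac1m]$-ring $I$. In the latter case $|R|=\aleph_0$ and $|V(\Lambda^1(R))|<\infty$. -/

import Mathlib

universe u

/-- An undirected graph without multiple edges in which loops are allowed. -/
structure LoopGraph where
  /-- The vertex set. -/
  V : Type u
  /-- Adjacency. -/
  Adj : V → V → Prop
  symm : ∀ v w, Adj v w → Adj w v

/-- `a ∼₁ b` iff `a` and `b` generate the same unital subring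
(`Subring.closure {a}` is the subring generated by `1` and `a`). -/
def unitalSetoid (R : Type u) [Ring R] : Setoid R where
  r a b := Subring.closure {a} = Subring.closure {b}
  iseqv := ⟨fun _ => rfl, fun h => h.symm, fun h h' => h.trans h'⟩

theorem commute_of_closure_eq {R : Type u} [Ring R] {a a' b b' : R}
    (ha : Subring.closure {a} = Subring.closure {a'})
    (hb : Subring.closure {b} = Subring.closure {b'}) (h : a * b = b * a) :
    a' * b' = b' * a' := by
  have key : ∀ {x y z : R}, Subring.closure {x} = Subring.closure {y} →
      x * z = z * x → y * z = z * y := by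
    intro x y z hxy hxz
    have hle : Subring.closure {x} ≤ Subring.centralizer {z} := by
      rw [Subring.closure_le]
      intro t ht
      rw [Set.mem_singleton_iff] at ht
      subst ht
      simp only [SetLike.mem_coe, Subring.mem_centralizer_iff, Set.mem_singleton_iff, forall_eq]
      exact hxz.symm
    have hy : y ∈ Subring.closure {x} := by
      rw [hxy]
      exact Subring.subset_closure rfl
    have := hle hy
    simp only [Subring.mem_centralizer_iff, Set.mem_singleton_iff, forall_eq] at this
    exact this.symm
  exact (key hb (key ha h).symm).symm

/-- The unital compressed commuting graph `Λ¹(R)`: its vertices are the classes of `∼₁`, and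
`[a]₁`, `[b]₁` are adjacent iff `a * b = b * a`. -/
def unitalCompressedCommutingGraph (R : Type u) [Ring R] : LoopGraph.{u} where
  V := Quotient (unitalSetoid R)
  Adj := Quotient.lift₂ (fun a b => a * b = b * a) (by
    intro a b a' b' ha hb
    exact propext ⟨commute_of_closure_eq ha hb, commute_of_closure_eq ha.symm hb.symm⟩)
  symm := by
    rintro ⟨a⟩ ⟨b⟩ h
    exact Eq.symm h

/-- A two-sided `Z`-ring structure on a (possibly nonunital) ring `I`: a `Z`-bimodule structure
compatible with the multiplication of `I`. If `Z` has an identity element, it is not required to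
act as the identity on `I`. -/
class TwoSidedRing (Z I : Type*) [NonUnitalRing Z] [NonUnitalRing I] where
  /-- The left action `z · x`. -/
  lsmul : Z → I → I
  /-- The right action `x · z`. -/
  rsmul : I → Z → I
  lsmul_add : ∀ z x y, lsmul z (x + y) = lsmul z x + lsmul z y
  add_lsmul : ∀ z w x, lsmul (z + w) x = lsmul z x + lsmul w x
  mul_lsmul : ∀ z w x, lsmul (z * w) x = lsmul z (lsmul w x)
  add_rsmul : ∀ x y z, rsmul (x + y) z = rsmul x z + rsmul y z
  rsmul_add : ∀ x z w, rsmul x (z + w) = rsmul x z + rsmul x w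
  rsmul_mul : ∀ x z w, rsmul x (z * w) = rsmul (rsmul x z) w
  lsmul_rsmul : ∀ z x w, rsmul (lsmul z x) w = lsmul z (rsmul x w)
  lsmul_mul_assoc : ∀ z (x y : I), lsmul z (x * y) = lsmul z x * y
  mul_lsmul_eq_rsmul_mul : ∀ (x : I) z y, x * lsmul z y = rsmul x z * y
  mul_rsmul_assoc : ∀ (x y : I) z, rsmul (x * y) z = x * rsmul y z

/-- The underlying set `Z × I` of the semidirect product `Z ⋉ I`. -/
@[ext]
structure RingSemidirect (Z I : Type*) where
  /-- The component in `Z`. -/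
  fst : Z
  /-- The component in `I`. -/
  snd : I

namespace RingSemidirect

open TwoSidedRing

instance instZero (Z I : Type*) [Zero Z] [Zero I] : Zero (RingSemidirect Z I) := ⟨⟨0, 0⟩⟩

instance instAdd (Z I : Type*) [Add Z] [Add I] : Add (RingSemidirect Z I) :=
  ⟨fun p q => ⟨p.fst + q.fst, p.snd + q.snd⟩⟩

instance instNeg (Z I : Type*) [Neg Z] [Neg I] : Neg (RingSemidirect Z I) :=
  ⟨fun p => ⟨-p.fst, -p.snd⟩⟩

instance instMul (Z I : Type*) [NonUnitalRing Z] [NonUnitalRing I] [TwoSidedRing Z I] :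
    Mul (RingSemidirect Z I) :=
  ⟨fun p q => ⟨p.fst * q.fst, lsmul p.fst q.snd + rsmul p.snd q.fst + p.snd * q.snd⟩⟩

/-- The ring `Z ⋉ I`: componentwise addition and
`(z₁, x₁) (z₂, x₂) = (z₁ z₂, z₁ · x₂ + x₁ · z₂ + x₁ x₂)`. -/
instance instNonUnitalRing (Z I : Type*) [NonUnitalRing Z] [NonUnitalRing I]
    [TwoSidedRing Z I] : NonUnitalRing (RingSemidirect Z I) where
  nsmul := nsmulRec
  zsmul := zsmulRec
  add_assoc p q r := RingSemidirect.ext (add_assoc _ _ _) (add_assoc _ _ _)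
  zero_add p := RingSemidirect.ext (zero_add _) (zero_add _)
  add_zero p := RingSemidirect.ext (add_zero _) (add_zero _)
  add_comm p q := RingSemidirect.ext (add_comm _ _) (add_comm _ _)
  neg_add_cancel p := RingSemidirect.ext (neg_add_cancel _) (neg_add_cancel _)
  left_distrib p q r := RingSemidirect.ext (mul_add _ _ _) (by
    change lsmul p.fst (q.snd + r.snd) + rsmul p.snd (q.fst + r.fst) + p.snd * (q.snd + r.snd) =
      (lsmul p.fst q.snd + rsmul p.snd q.fst + p.snd * q.snd) +
        (lsmul p.fst r.snd + rsmul p.snd r.fst + p.snd * r.snd)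
    rw [lsmul_add, rsmul_add, mul_add]
    abel)
  right_distrib p q r := RingSemidirect.ext (add_mul _ _ _) (by
    change lsmul (p.fst + q.fst) r.snd + rsmul (p.snd + q.snd) r.fst + (p.snd + q.snd) * r.snd =
      (lsmul p.fst r.snd + rsmul p.snd r.fst + p.snd * r.snd) +
        (lsmul q.fst r.snd + rsmul q.snd r.fst + q.snd * r.snd)
    rw [add_lsmul, add_rsmul, add_mul]
    abel)
  zero_mul p := RingSemidirect.ext (zero_mul _) (by
    change lsmul (0 : Z) p.snd + rsmul (0 : I) p.fst + 0 * p.snd = 0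
    have h₁ : lsmul (0 : Z) p.snd = 0 := by simpa using add_lsmul (0 : Z) 0 p.snd
    have h₂ : rsmul (0 : I) p.fst = 0 := by simpa using add_rsmul (0 : I) 0 p.fst
    rw [h₁, h₂, zero_mul, add_zero, add_zero])
  mul_zero p := RingSemidirect.ext (mul_zero _) (by
    change lsmul p.fst (0 : I) + rsmul p.snd (0 : Z) + p.snd * 0 = 0
    have h₁ : lsmul p.fst (0 : I) = 0 := by simpa using lsmul_add p.fst (0 : I) 0
    have h₂ : rsmul p.snd (0 : Z) = 0 := by simpa using rsmul_add p.snd (0 : Z) 0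
    rw [h₁, h₂, mul_zero, add_zero, add_zero])
  mul_assoc p q r := RingSemidirect.ext (mul_assoc _ _ _) (by
    change lsmul (p.fst * q.fst) r.snd +
        rsmul (lsmul p.fst q.snd + rsmul p.snd q.fst + p.snd * q.snd) r.fst +
        (lsmul p.fst q.snd + rsmul p.snd q.fst + p.snd * q.snd) * r.snd =
      lsmul p.fst (lsmul q.fst r.snd + rsmul q.snd r.fst + q.snd * r.snd) +
        rsmul p.snd (q.fst * r.fst) +
        p.snd * (lsmul q.fst r.snd + rsmul q.snd r.fst + q.snd * r.snd)
    simp only [mul_lsmul, lsmul_add, add_rsmul, rsmul_mul, lsmul_rsmul, add_mul, mul_add,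
      lsmul_mul_assoc, mul_lsmul_eq_rsmul_mul, mul_rsmul_assoc, mul_assoc]
    abel)

/-- `Z ⋉ I` is a unital semidirect product: `Z` is unital and `I` contains an idempotent `e` with
`1 · x = x - e x` and `x · 1 = x - x e` for all `x`. -/
def IsUnital (Z I : Type*) [Ring Z] [NonUnitalRing I] [TwoSidedRing Z I] : Prop :=
  ∃ e : I, e * e = e ∧
    (∀ x : I, lsmul (1 : Z) x = x - e * x) ∧ (∀ x : I, rsmul x (1 : Z) = x - x * e)

end RingSemidirect

/-- The ring `ℤ[1/m]`, as the subring of `ℚ` generated by `1/m`. -/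
abbrev ZInv (m : ℕ) : Subalgebra ℤ ℚ := Algebra.adjoin ℤ {1 / (m : ℚ)}

/-- `R` is isomorphic to a unital semidirect product `ℤ[1/m] ⋉ I` for some positive integer `m` and
some finite `ℤ[1/m]`-ring `I`. (An isomorphism of rings preserves the identity element, as the
latter is determined by the multiplication.) -/
def IsUnitalSemidirectZInv (R : Type u) [Ring R] : Prop :=
  ∃ m : ℕ, 0 < m ∧ ∃ (I : Type u) (_ : NonUnitalRing I) (_ : TwoSidedRing (ZInv m) I),
    Finite I ∧ RingSemidirect.IsUnital (ZInv m) I ∧ Nonempty (R ≃+* RingSemidirect (ZInv m) I)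

open Polynomial

/-! Vertices correspond to the subrings generated by one element. Each such subring is countable, so
every class is countable, and an infinite vertex set has the cardinality of `R`. Suppose there are
finitely many vertices. Comparing the subrings generated by prime multiples of `a` yields a relation
`n • a = k` with integers `n ≠ 0` and `k` (`exists_zsmul_eq_intCast`), so `a ↦ k / n` is a
homomorphism `π : R → ℚ` with torsion kernel. Pigeonhole arguments also make the torsion finite
(`finite_torsion`) and the image some `ℤ[1/m]` (`exists_range_eq_zInv`). As the kernel is finite, a
power of a lift of `1` is an idempotent that carries a copy of `ℤ[1/m]` in `R`; this splits `π`
(`exists_section`). Conversely, if `π` has finite kernel and image in `ℤ[1/m]`, each one-generated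
subring is determined by its kernel part and one lift of some `1/d` with `d ∣ m`, which leaves
finitely many choices. -/

theorem finite_vertices_iff (R : Type u) [Ring R] :
    Finite (unitalCompressedCommutingGraph R).V ↔
      (Set.range fun a : R => Subring.closure {a}).Finite :=
  (Setoid.quotientKerEquivRange fun a : R => Subring.closure {a}).finite_iff

theorem mem_closure_singleton_iff_aeval {R : Type*} [Ring R] {a x : R} :
    x ∈ Subring.closure {a} ↔ ∃ p : ℤ[X], aeval a p = x := by
  rw [← AlgHom.mem_range, ← Algebra.adjoin_singleton_eq_range_aeval, Algebra.adjoin_int]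
  rfl

/-- Pseudo-division in `ℤ[X]`. -/
theorem exists_pseudo_division (μ : ℤ[X]) (hμ : μ ≠ 0) (h : ℤ[X]) :
    ∃ (k : ℕ) (Q r : ℤ[X]), C (μ.leadingCoeff ^ k) * h = μ * Q + r ∧ r.degree < μ.degree := by
  induction hd : h.degree using WellFoundedLT.induction generalizing h with
  | ind d ih =>
  rcases lt_or_ge h.degree μ.degree with hlt | hle
  · exact ⟨0, 0, h, by simp, hlt⟩
  have h0 : h ≠ 0 := by
    rintro rfl
    simp [hμ] at hle
  have hn : μ.natDegree ≤ h.natDegree := natDegree_le_natDegree hle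
  have hl : μ.leadingCoeff ≠ 0 := leadingCoeff_ne_zero.2 hμ
  have hl' : h.leadingCoeff ≠ 0 := leadingCoeff_ne_zero.2 h0
  set g := C h.leadingCoeff * X ^ (h.natDegree - μ.natDegree) with hg
  have h1 : (C μ.leadingCoeff * h).degree = h.degree := by
    rw [degree_mul, degree_C hl, zero_add]
  have h2 : (μ * g).degree = h.degree := by
    rw [degree_mul, hg, degree_C_mul_X_pow _ hl', degree_eq_natDegree hμ, degree_eq_natDegree h0]
    norm_cast
    omega
  have h3 : (C μ.leadingCoeff * h).leadingCoeff = (μ * g).leadingCoeff := by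
    rw [leadingCoeff_mul, leadingCoeff_mul, hg, leadingCoeff_C_mul_X_pow, leadingCoeff_C]
  have h4 := degree_sub_lt_left (h1.trans h2.symm) (mul_ne_zero (C_ne_zero.2 hl) h0) h3
  rw [h1] at h4
  obtain ⟨k, Q, r, hk, hr⟩ := ih _ (hd ▸ h4) _ rfl
  refine ⟨k + 1, Q + C (μ.leadingCoeff ^ k) * g, r, ?_, hr⟩
  rw [pow_succ, C_mul]
  linear_combination hk

/-! ### Polynomial relations from the pigeonhole principle -/

theorem exists_closure_eq {R : Type*} [Ring R]
    (H : (Set.range fun a : R => Subring.closure {a}).Finite) {ι : Type*} [Infinite ι] (f : ι → R) :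
    ∃ i j, i ≠ j ∧ Subring.closure {f i} = Subring.closure {f j} := by
  have := H.to_subtype
  obtain ⟨i, j, hij, h⟩ := Finite.exists_ne_map_eq_of_infinite
    (fun i => (⟨Subring.closure {f i}, f i, rfl⟩ : Set.range fun a : R => Subring.closure {a}))
  exact ⟨i, j, hij, congrArg Subtype.val h⟩

/-- Two powers of `t` generate the same subring. The coefficient `1` keeps the relation nonzero
modulo every prime. -/
theorem exists_aeval_eq_zero_coeff_eq_one {R : Type*} [Ring R]
    (H : (Set.range fun a : R => Subring.closure {a}).Finite) (t : R) :
    ∃ (P : ℤ[X]) (i : ℕ), P.coeff i = 1 ∧ aeval t P = 0 := by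
  obtain ⟨i, j, hij, h⟩ := exists_closure_eq H fun i : ℕ => t ^ (i + 1)
  wlog hlt : i < j generalizing i j
  · exact this j i hij.symm h.symm (by omega)
  have hm : t ^ (i + 1) ∈ Subring.closure {t ^ (j + 1)} := h ▸ Subring.subset_closure rfl
  obtain ⟨p, hp⟩ := mem_closure_singleton_iff_aeval.1 hm
  -- Only exponents divisible by `j + 1` occur in the second term, and `0 < i + 1 < j + 1`.
  refine ⟨X ^ (i + 1) - expand ℤ (j + 1) p, i + 1, ?_, ?_⟩
  · rw [coeff_sub, coeff_X_pow_self, coeff_expand (by omega), if_neg, sub_zero]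
    exact Nat.not_dvd_of_pos_of_lt (by omega) (by omega)
  · rw [map_sub, expand_aeval, hp, map_pow, aeval_X, sub_self]

/-- If `q' • a = g(q • a)` for primes `q ≠ q'`, then `g(qX) - q'X` kills `a`, and modulo `q` it is
`g(0) - q'X`. -/
theorem exists_aeval_eq_zero_degree_map_eq_one {R : Type*} [Ring R]
    (H : (Set.range fun a : R => Subring.closure {a}).Finite) (a : R) (B : ℕ) :
    ∃ (q : ℕ) (h : ℤ[X]), q.Prime ∧ B < q ∧ aeval a h = 0 ∧
      (h.map (Int.castRingHom (ZMod q))).degree = 1 := by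
  have : Infinite {q : ℕ // q.Prime ∧ B < q} := by
    refine Set.infinite_coe_iff.2 (Set.infinite_of_forall_exists_gt fun n => ?_)
    obtain ⟨q, hq, hp⟩ := Nat.exists_infinite_primes (n + B + 1)
    exact ⟨q, ⟨hp, by omega⟩, by omega⟩
  obtain ⟨⟨q', hq', hB'⟩, ⟨q, hq, hB⟩, hne, h⟩ :=
    exists_closure_eq H fun q : {q : ℕ // q.Prime ∧ B < q} => (q : ℕ) • a
  have hm : q' • a ∈ Subring.closure {q • a} := h ▸ Subring.subset_closure rfl
  obtain ⟨g, hg⟩ := mem_closure_singleton_iff_aeval.1 hm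
  refine ⟨q, g.comp (C (q : ℤ) * X) - C (q' : ℤ) * X, hq, hB, ?_, ?_⟩
  · have e (n : ℕ) : aeval a (C (n : ℤ) * X) = n • a := by simp [nsmul_eq_mul]
    rw [map_sub, aeval_comp, e, e, hg, sub_self]
  · have := Fact.mk hq
    have h0 : (-(q' : ZMod q)) ≠ 0 := by
      rw [neg_ne_zero, Ne, ZMod.natCast_eq_zero_iff, Nat.prime_dvd_prime_iff_eq hq hq']
      rintro rfl
      exact hne rfl
    have : (g.comp (C (q : ℤ) * X) - C (q' : ℤ) * X).map (Int.castRingHom (ZMod q)) =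
        C (-(q' : ZMod q)) * X + C (((g.coeff 0 : ℤ)) : ZMod q) := by
      rw [Polynomial.map_sub, Polynomial.map_comp]
      simp [comp_zero, ← coeff_zero_eq_eval_zero]
      ring
    rw [this, degree_linear h0]

/-! ### The homomorphism to `ℚ` -/

/-- A nonzero annihilator `μ` of least degree divides every annihilator up to a power of its leading
coefficient. Reducing modulo a prime `q` too large to divide that coefficient, `μ` divides a linear
polynomial without losing degree. -/
theorem exists_zsmul_eq_intCast {R : Type*} [Ring R]
    (H : (Set.range fun a : R => Subring.closure {a}).Finite) [CharZero R] (a : R) :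
    ∃ n k : ℤ, n ≠ 0 ∧ n • a = k := by
  let S : Set ℤ[X] := {μ | μ ≠ 0 ∧ aeval a μ = 0}
  have hS : S.Nonempty := by
    obtain ⟨q, h, hq, -, h0, h1⟩ := exists_aeval_eq_zero_degree_map_eq_one H a 0
    refine ⟨h, ?_, h0⟩
    rintro rfl
    simp at h1
  obtain ⟨μ, ⟨hμ, hμa⟩, hmin⟩ := WellFounded.has_min (measure natDegree).wf S hS
  obtain ⟨q, h, hq, hB, h0, h1⟩ :=
    exists_aeval_eq_zero_degree_map_eq_one H a μ.leadingCoeff.natAbs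
  have := Fact.mk hq
  obtain ⟨k, Q, r, hk, hr⟩ := exists_pseudo_division μ hμ h
  have hr0 : r = 0 := by
    by_contra hr0
    refine hmin r ⟨hr0, ?_⟩ (natDegree_lt_natDegree hr0 hr)
    have := congrArg (aeval a) hk
    simpa [h0, hμa] using this.symm
  have hl : Int.castRingHom (ZMod q) μ.leadingCoeff ≠ 0 := by
    rw [eq_intCast, Ne, ZMod.intCast_zmod_eq_zero_iff_dvd]
    intro hd
    have := Nat.le_of_dvd (Int.natAbs_pos.2 (leadingCoeff_ne_zero.2 hμ)) (Int.natCast_dvd.1 hd)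
    omega
  have hdeg := congrArg (fun p => (p.map (Int.castRingHom (ZMod q))).degree) hk
  simp only [hr0, add_zero, Polynomial.map_mul, degree_mul, h1,
    degree_map_eq_of_leadingCoeff_ne_zero _ hl] at hdeg
  rw [map_C, map_pow, degree_C (pow_ne_zero _ hl), zero_add] at hdeg
  have hle : μ.degree ≤ 1 := by
    rw [hdeg]
    refine le_add_of_nonneg_right (zero_le_degree_iff.2 fun hQ => ?_)
    rw [hQ] at hdeg
    simp at hdeg
  have hrep := eq_X_add_C_of_degree_le_one hle
  refine ⟨μ.coeff 1, -μ.coeff 0, fun hz => ?_, ?_⟩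
  · rw [hz, C_0, zero_mul, zero_add] at hrep
    rw [hrep, aeval_C, eq_intCast, Int.cast_eq_zero] at hμa
    exact hμ (by rw [hrep, hμa, C_0])
  · rw [hrep] at hμa
    rw [map_add, map_mul, aeval_C, aeval_C, aeval_X, eq_intCast, eq_intCast] at hμa
    rw [zsmul_eq_mul, Int.cast_neg, eq_neg_of_add_eq_zero_left hμa]

theorem exists_ringHom_rat {R : Type*} [Ring R]
    (H : (Set.range fun a : R => Subring.closure {a}).Finite) [CharZero R] :
    ∃ π : R →+* ℚ, ∀ a, π a = 0 → IsOfFinAddOrder a := by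
  choose n k hn hk using exists_zsmul_eq_intCast H
  -- The ratio is independent of the chosen relation, so each homomorphism law needs only one
  -- convenient relation.
  have key (a : R) (N K : ℤ) (hN : N ≠ 0) (h : N • a = K) : (k a / n a : ℚ) = K / N := by
    rw [div_eq_div_iff (by exact_mod_cast hn a) (by exact_mod_cast hN)]
    have : ((k a * N : ℤ) : R) = (K * n a : ℤ) := by
      push_cast
      rw [← hk, ← h, zsmul_eq_mul, zsmul_eq_mul, (Int.cast_commute (n a) a).eq, mul_assoc,
        mul_assoc, (Int.cast_commute N _).eq, mul_assoc]
    exact_mod_cast this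
  refine ⟨{ toFun := fun a => k a / n a, map_one' := ?_, map_mul' := ?_, map_zero' := ?_,
            map_add' := ?_ }, ?_⟩
  · rw [key 1 1 1 one_ne_zero (by simp)]
    simp
  · intro a b
    rw [key (a * b) (n a * n b) (k a * k b) (mul_ne_zero (hn a) (hn b))]
    · push_cast
      rw [mul_div_mul_comm]
    · push_cast
      rw [← hk, ← hk, smul_mul_smul_comm]
  · rw [key 0 1 0 one_ne_zero (by simp)]
    simp
  · intro a b
    rw [key (a + b) (n a * n b) (k a * n b + n a * k b) (mul_ne_zero (hn a) (hn b))]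
    · push_cast
      rw [div_add_div]
      · exact_mod_cast hn a
      · exact_mod_cast hn b
    · push_cast
      rw [← hk, ← hk]
      simp only [zsmul_eq_mul, Int.cast_mul, mul_add]
      congr 1
      · rw [(Int.cast_commute (n a) (n b : R)).eq, mul_assoc, (Int.cast_commute (n b) _).eq]
      · rw [mul_assoc]
  · intro a ha
    have hka : k a = 0 := by
      have : (k a / n a : ℚ) = 0 := ha
      rw [div_eq_zero_iff] at this
      rcases this with h | h
      · exact_mod_cast h
      · exact absurd (by exact_mod_cast h) (hn a)
    refine isOfFinAddOrder_iff_zsmul_eq_zero.2 ⟨n a, hn a, ?_⟩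
    rw [hk, hka, Int.cast_zero]

/-! ### Finiteness of the torsion -/

theorem finite_isOfFinAddOrder_intCast (R : Type*) [Ring R] :
    {x : R | IsOfFinAddOrder x ∧ ∃ c : ℤ, (c : R) = x}.Finite := by
  by_cases h : CharZero R
  · refine (Set.finite_singleton (0 : R)).subset ?_
    rintro _ ⟨hx, c, rfl⟩
    obtain ⟨n, hn, hnc⟩ := isOfFinAddOrder_iff_zsmul_eq_zero.1 hx
    rw [zsmul_eq_mul, ← Int.cast_mul, Int.cast_eq_zero] at hnc
    simp [(mul_eq_zero.1 hnc).resolve_left hn]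
  · have hchar : ringChar R ≠ 0 := fun h0 => h (CharP.ringChar_zero_iff_CharZero R |>.1 h0)
    have : NeZero (ringChar R) := ⟨hchar⟩
    refine (Set.finite_range (ZMod.castHom dvd_rfl R : ZMod (ringChar R) →+* R)).subset ?_
    rintro _ ⟨-, c, rfl⟩
    exact ⟨c, map_intCast _ c⟩

/-- Isolates the constant term: any integer that annihilates `a` annihilates the rest. -/
theorem mem_closure_singleton_iff_add_mul {R : Type*} [Ring R] {a x : R} :
    x ∈ Subring.closure {a} ↔ ∃ (c : ℤ) (g : ℤ[X]), c + a * aeval a g = x := by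
  rw [mem_closure_singleton_iff_aeval]
  constructor
  · rintro ⟨p, rfl⟩
    refine ⟨p.coeff 0, p.divX, ?_⟩
    conv_rhs => rw [← X_mul_divX_add p]
    simp [add_comm]
  · rintro ⟨c, g, rfl⟩
    exact ⟨C c + X * g, by simp⟩

/-- Since `p • t = 0`, the value depends only on `g` modulo `p`; since `P` kills `t`, only on the
remainder of that reduction by the nonzero polynomial `P` modulo `p`. -/
theorem finite_range_mul_aeval {R : Type*} [Ring R] {p : ℕ} (hp : p.Prime) {t : R}
    (ht : p • t = 0) {P : ℤ[X]} {i : ℕ} (hi : P.coeff i = 1) (hP : aeval t P = 0) :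
    (Set.range fun g : ℤ[X] => t * aeval t g).Finite := by
  have := Fact.mk hp
  let φ := mapRingHom (Int.castRingHom (ZMod p))
  have hφ : Function.Surjective φ := map_surjective _ (ZMod.ringHom_surjective _)
  have hP0 : φ P ≠ 0 := by
    intro h
    have := congrArg (fun f => f.coeff i) h
    simp [φ, hi] at this
  have hker (g g' : ℤ[X]) (h : φ g = φ g') : t * aeval t g = t * aeval t g' := by
    rw [← sub_eq_zero, ← mul_sub, ← map_sub]
    have h0 : φ (g - g') = 0 := by rw [map_sub, h, sub_self]
    have hd : C (p : ℤ) ∣ g - g' := by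
      rw [C_dvd_iff_dvd_coeff]
      intro j
      have := congrArg (fun f => f.coeff j) h0
      rw [← ZMod.intCast_zmod_eq_zero_iff_dvd]
      simpa [φ] using this
    obtain ⟨k, hk⟩ := hd
    rw [hk, map_mul, aeval_C, ← mul_assoc]
    have : t * (algebraMap ℤ R p) = 0 := by simpa [nsmul_eq_mul, Nat.cast_comm] using ht
    rw [this, zero_mul]
  have hfin : Finite (degreeLT (ZMod p) (φ P).natDegree) :=
    Finite.of_equiv _ (degreeLTEquiv (ZMod p) (φ P).natDegree).symm.toEquiv
  refine (Set.finite_range fun r : degreeLT (ZMod p) (φ P).natDegree =>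
    t * aeval t (Function.surjInv hφ r)).subset ?_
  rintro _ ⟨g, rfl⟩
  refine ⟨⟨φ g % φ P, ?_⟩, ?_⟩
  · rw [mem_degreeLT, ← degree_eq_natDegree hP0]
    exact EuclideanDomain.mod_lt _ hP0
  · obtain ⟨Q, hQ⟩ := hφ (φ g / φ P)
    have : t * aeval t g = t * aeval t (g - P * Q) := by simp [hP]
    change _ = t * aeval t g
    rw [this]
    refine hker _ _ ?_
    rw [Function.surjInv_eq hφ, map_sub, map_mul, hQ]
    exact EuclideanDomain.mod_eq_sub_mul_div _ _

/-- Finitely many of the subrings generated by elements of `T` cover `T`. -/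
theorem finite_of_finite_closure_inter {R : Type*} [Ring R]
    (H : (Set.range fun a : R => Subring.closure {a}).Finite) {T : Set R}
    (hT : ∀ t ∈ T, ((Subring.closure {t} : Set R) ∩ T).Finite) : T.Finite := by
  have hfin : (Set.image (fun a : R => Subring.closure {a}) T).Finite :=
    H.subset (Set.image_subset_range _ _)
  refine (hfin.biUnion (t := fun A => (A : Set R) ∩ T) ?_).subset ?_
  · rintro _ ⟨t, ht, rfl⟩
    exact hT t ht
  · intro t ht
    exact Set.mem_biUnion ⟨t, ht, rfl⟩ ⟨Subring.subset_closure rfl, ht⟩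

theorem finite_prime_torsion {R : Type*} [Ring R]
    (H : (Set.range fun a : R => Subring.closure {a}).Finite) {p : ℕ} (hp : p.Prime) :
    {t : R | p • t = 0}.Finite := by
  refine finite_of_finite_closure_inter H fun t ht => ?_
  obtain ⟨P, i, hi, hP⟩ := exists_aeval_eq_zero_coeff_eq_one H t
  refine ((finite_isOfFinAddOrder_intCast R).add
    (finite_range_mul_aeval hp ht hi hP)).subset ?_
  rintro x ⟨hx, hpx⟩
  obtain ⟨c, g, rfl⟩ := mem_closure_singleton_iff_add_mul.1 hx
  refine Set.add_mem_add ⟨isOfFinAddOrder_iff_nsmul_eq_zero.2 ⟨p, hp.pos, ?_⟩, c, rfl⟩ ⟨g, rfl⟩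
  have ht' : p • t = 0 := ht
  have hpx' : p • ((c : R) + t * aeval t g) = 0 := hpx
  rwa [smul_add, ← smul_mul_assoc, ht', zero_mul, add_zero] at hpx'

theorem finite_nsmul_torsion {R : Type*} [Ring R]
    (H : (Set.range fun a : R => Subring.closure {a}).Finite) {n : ℕ} (hn : n ≠ 0) :
    {t : R | n • t = 0}.Finite := by
  induction n using induction_on_primes with
  | zero => exact absurd rfl hn
  | one => simp
  | prime_mul p n hp ih =>
    have hsub : {t : R | (p * n) • t = 0} = (p • · : R → R) ⁻¹' {t | n • t = 0} := by
      ext t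
      simp [mul_comm p n, mul_smul]
    rw [hsub]
    -- Nonempty fibres of multiplication by `p` are cosets of the `p`-torsion.
    refine (ih (right_ne_zero_of_mul hn)).preimage' fun b _ => ?_
    rcases Set.eq_empty_or_nonempty ((p • · : R → R) ⁻¹' {b}) with he | ⟨x, hx⟩
    · rw [he]
      exact Set.finite_empty
    · refine ((finite_prime_torsion H hp).image (x + ·)).subset fun y hy => ⟨y - x, ?_, by simp⟩
      simp only [Set.mem_preimage, Set.mem_singleton_iff] at hx hy
      rw [Set.mem_ofPred_eq, smul_sub, hx, hy, sub_self]

theorem finite_torsion {R : Type*} [Ring R]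
    (H : (Set.range fun a : R => Subring.closure {a}).Finite) :
    {t : R | IsOfFinAddOrder t}.Finite := by
  by_cases h : CharZero R
  · refine finite_of_finite_closure_inter H fun t ht => ?_
    obtain ⟨n, hn, hnt⟩ := isOfFinAddOrder_iff_nsmul_eq_zero.1 ht
    refine (finite_nsmul_torsion H hn.ne').subset ?_
    rintro x ⟨hx, hxT⟩
    obtain ⟨c, g, rfl⟩ := mem_closure_singleton_iff_add_mul.1 hx
    obtain ⟨N, hN, hNx⟩ := isOfFinAddOrder_iff_nsmul_eq_zero.1 hxT
    have h1 : n • (t * aeval t g) = 0 := by rw [← smul_mul_assoc, hnt, zero_mul]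
    have h2 : n • N • (c : R) = 0 := by
      have h3 := congrArg (n • ·) hNx
      rwa [smul_add, smul_add, smul_comm n N (t * _), h1, smul_zero, smul_zero, add_zero] at h3
    -- A torsion integer vanishes in characteristic zero, so `n` kills all torsion in the subring
    -- generated by `t`.
    have hc : c = 0 := by
      rw [nsmul_eq_mul, nsmul_eq_mul] at h2
      have h4 : (n : ℤ) * (N * c) = 0 := by exact_mod_cast h2
      simpa [hn.ne', hN.ne'] using h4
    rw [Set.mem_ofPred_eq, hc, Int.cast_zero, zero_add, h1]
  · have hchar : ringChar R ≠ 0 := fun h0 => h (CharP.ringChar_zero_iff_CharZero R |>.1 h0)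
    refine (finite_nsmul_torsion H hchar).subset fun x _ => ?_
    simp [nsmul_eq_mul]

theorem charZero_of_finite_range_closure {R : Type*} [Ring R] [Infinite R]
    (H : (Set.range fun a : R => Subring.closure {a}).Finite) : CharZero R := by
  by_contra h
  have hchar : ringChar R ≠ 0 := fun h0 => h (CharP.ringChar_zero_iff_CharZero R |>.1 h0)
  refine Set.infinite_univ ((finite_nsmul_torsion H hchar).subset fun x _ => ?_)
  simp [nsmul_eq_mul]

/-! ### Subrings of `ℚ` and the image of `π` -/

theorem mem_zInv_iff {m : ℕ} (hm : 0 < m) {z : ℚ} :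
    z ∈ ZInv m ↔ ∃ (k : ℤ) (j : ℕ), z = k / (m : ℚ) ^ j := by
  have hm' : (m : ℚ) ≠ 0 := by exact_mod_cast hm.ne'
  constructor
  · intro hz
    induction hz using Algebra.adjoin_induction with
    | mem x hx =>
      rw [Set.mem_singleton_iff] at hx
      exact ⟨1, 1, by simp [hx]⟩
    | algebraMap r => exact ⟨r, 0, by simp⟩
    | add x y _ _ hx hy =>
      obtain ⟨k, i, rfl⟩ := hx
      obtain ⟨l, j, rfl⟩ := hy
      refine ⟨k * m ^ j + m ^ i * l, i + j, ?_⟩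
      push_cast
      rw [div_add_div _ _ (pow_ne_zero _ hm') (pow_ne_zero _ hm'), pow_add]
    | mul x y _ _ hx hy =>
      obtain ⟨k, i, rfl⟩ := hx
      obtain ⟨l, j, rfl⟩ := hy
      refine ⟨k * l, i + j, ?_⟩
      push_cast
      rw [div_mul_div_comm, pow_add]
  · rintro ⟨k, j, rfl⟩
    have h : (1 / m : ℚ) ∈ ZInv m := Algebra.subset_adjoin rfl
    have := (ZInv m).zsmul_mem ((ZInv m).pow_mem h j) k
    rwa [zsmul_eq_mul, one_div_pow, mul_one_div] at this

theorem one_div_den_mem {B : Subring ℚ} {x : ℚ} (hx : x ∈ B) : 1 / (x.den : ℚ) ∈ B := by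
  obtain ⟨u, v, huv⟩ : IsCoprime x.num x.den := by
    rw [Int.isCoprime_iff_gcd_eq_one]
    exact x.reduced
  have hd : (x.den : ℚ) ≠ 0 := by exact_mod_cast x.den_nz
  have : 1 / (x.den : ℚ) = u * x + v := by
    have h : (u * x.num + v * x.den : ℚ) = 1 := by exact_mod_cast huv
    have hx : x * x.den = x.num := Rat.mul_den_eq_num x
    field_simp
    rw [← h, ← hx]
    ring
  rw [this]
  exact B.add_mem (B.mul_mem (intCast_mem B u) hx) (intCast_mem B v)

theorem one_div_mem_of_dvd {B : Subring ℚ} {d D : ℕ} (hD : D ≠ 0) (hd : d ∣ D)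
    (h : 1 / (D : ℚ) ∈ B) : 1 / (d : ℚ) ∈ B := by
  obtain ⟨c, rfl⟩ := hd
  have : 1 / (d : ℚ) = c * (1 / ((d * c : ℕ) : ℚ)) := by
    have h1 : (d : ℚ) ≠ 0 := by exact_mod_cast left_ne_zero_of_mul hD
    have h2 : (c : ℚ) ≠ 0 := by exact_mod_cast right_ne_zero_of_mul hD
    push_cast
    field_simp
  rw [this]
  exact B.mul_mem (natCast_mem B c) h

/-- If only finitely many subrings of `R` are generated by one element, then the image of any
homomorphism `R → ℚ` is some `ℤ[1/m]`. -/
theorem exists_range_eq_zInv {R : Type*} [Ring R]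
    (H : (Set.range fun a : R => Subring.closure {a}).Finite) (π : R →+* ℚ) :
    ∃ m : ℕ, 0 < m ∧ ∀ z, z ∈ π.range ↔ z ∈ ZInv m := by
  have := H.fintype
  choose a ha using fun A : Set.range fun a : R => Subring.closure {a} => A.2
  have hpos : 0 < ∏ A, (π (a A)).den := Finset.prod_pos fun A _ => (π (a A)).den_pos
  -- Inverting the denominators of one generator per subring suffices, since every element lies in
  -- one of these subrings.
  refine ⟨∏ A, (π (a A)).den, hpos, fun z => ⟨?_, fun hz => ?_⟩⟩
  · rintro ⟨x, rfl⟩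
    let A₀ : Set.range fun a : R => Subring.closure {a} := ⟨Subring.closure {x}, x, rfl⟩
    have hx : x ∈ Subring.closure {a A₀} := by
      have := ha A₀
      dsimp only at this
      rw [this]
      exact Subring.subset_closure rfl
    have hle : Subring.closure {a A₀} ≤ (ZInv (∏ A, (π (a A)).den)).toSubring.comap π := by
      rw [Subring.closure_le, Set.singleton_subset_iff]
      change π (a A₀) ∈ ZInv _
      have h1 : (1 : ℚ) / ((π (a A₀)).den : ℕ) ∈ (ZInv (∏ A, (π (a A)).den)).toSubring :=
        one_div_mem_of_dvd hpos.ne' (Finset.dvd_prod_of_mem _ (Finset.mem_univ _))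
          (Algebra.subset_adjoin rfl)
      have := mul_mem (intCast_mem _ (π (a A₀)).num) h1
      rwa [mul_one_div, Rat.num_div_den] at this
    exact hle hx
  · have hm : (1 / ((∏ A, (π (a A)).den : ℕ) : ℚ)) ∈ π.range := by
      rw [Nat.cast_prod, one_div, ← Finset.prod_inv_distrib]
      refine prod_mem fun A _ => ?_
      rw [← one_div]
      exact one_div_den_mem ⟨a A, rfl⟩
    have : Algebra.adjoin ℤ {1 / ((∏ A, (π (a A)).den : ℕ) : ℚ)} ≤
        subalgebraOfSubring π.range :=
      Algebra.adjoin_le (Set.singleton_subset_iff.2 hm)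
    exact this hz

/-- Finiteness of the set of subrings generated by one element, from a map to `ℚ` with finite
kernel and image in `ℤ[1/m]`. -/
theorem finite_range_closure_of_ringHom {R : Type*} [Ring R] (π : R →+* ℚ)
    (hker : {x | π x = 0}.Finite) {m : ℕ} (hm : 0 < m) (hπ : ∀ x, π x ∈ ZInv m) :
    (Set.range fun a : R => Subring.closure {a}).Finite := by
  have hfib (q : ℚ) : (π ⁻¹' {q}).Finite := by
    rcases Set.eq_empty_or_nonempty (π ⁻¹' {q}) with he | ⟨x, hx⟩
    · rw [he]
      exact Set.finite_empty
    · refine (hker.image (x + ·)).subset fun y hy => ⟨y - x, ?_, by simp⟩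
      simp only [Set.mem_preimage, Set.mem_singleton_iff] at hx hy
      simp [hx, hy]
  have hF : (⋃ d ∈ m.divisors, π ⁻¹' {1 / (d : ℚ)}).Finite :=
    m.divisors.finite_toSet.biUnion fun d _ => hfib _
  refine ((hF.prod hker.finite_subsets).image
    fun p => Subring.closure ({p.1} ∪ p.2)).subset ?_
  rintro _ ⟨a, rfl⟩
  set A := Subring.closure {a} with hA
  set D := (π a).den with hD
  -- `D` divides a power of `m`, so `d` has the same prime factors as `D`, but it takes only
  -- finitely many values.
  set d := D.gcd m with hd
  have hdm : d ∣ m := Nat.gcd_dvd_right _ _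
  have hDd : ∃ j, D ∣ d ^ j := by
    obtain ⟨k, j, hkj⟩ := (mem_zInv_iff hm).1 (hπ a)
    have h1 : D ∣ m ^ j := by
      have := Rat.den_dvd k ((m : ℤ) ^ j)
      rw [Rat.divInt_eq_div] at this
      push_cast at this
      rw [← hkj] at this
      exact_mod_cast this
    -- The exponent must be positive for `D` to divide its own power.
    refine ⟨j + 1, ?_⟩
    rw [hd, ← Nat.pow_gcd_pow]
    exact Nat.dvd_gcd (dvd_pow_self _ (by omega)) (h1.trans (pow_dvd_pow _ (by omega)))
  have haA : a ∈ A := Subring.subset_closure rfl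
  have hdA : 1 / (d : ℚ) ∈ A.map π :=
    one_div_mem_of_dvd (π a).den_nz (Nat.gcd_dvd_left _ _) (one_div_den_mem ⟨a, haA, rfl⟩)
  obtain ⟨b, hbA, hb⟩ := Subring.mem_map.1 hdA
  refine ⟨(b, {x | x ∈ A ∧ π x = 0}), ⟨?_, fun x hx => hx.2⟩, ?_⟩
  · exact Set.mem_biUnion (Nat.mem_divisors.2 ⟨hdm, hm.ne'⟩) hb
  · refine le_antisymm ?_ ?_
    · rw [Subring.closure_le]
      rintro x (hx | hx)
      · rw [Set.mem_singleton_iff] at hx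
        exact hx ▸ hbA
      · exact hx.1
    · have hle : Subring.closure {b} ≤ A := by
        rw [Subring.closure_le, Set.singleton_subset_iff]
        exact hbA
      have hle' : Subring.closure {b} ≤ Subring.closure ({b} ∪ {x | x ∈ A ∧ π x = 0}) :=
        Subring.closure_mono Set.subset_union_left
      -- Thus `a` differs from an element of the subring generated by `b` by a kernel element of
      -- `A`.
      have hza : π a ∈ (Subring.closure {b}).map π := by
        obtain ⟨j, hj⟩ := hDd
        have h1 : 1 / ((d ^ j : ℕ) : ℚ) ∈ (Subring.closure {b}).map π := by
          rw [Nat.cast_pow, ← one_div_pow, ← hb]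
          exact Subring.pow_mem _
            (Subring.mem_map.2 ⟨b, Subring.mem_closure_of_mem (Set.mem_singleton b), rfl⟩) j
        have h2 := one_div_mem_of_dvd
          (pow_ne_zero _ (Nat.gcd_pos_of_pos_right _ hm).ne') hj h1
        have := Subring.mul_mem _ (intCast_mem ((Subring.closure {b}).map π) (π a).num) h2
        rwa [mul_one_div, hD, Rat.num_div_den] at this
      obtain ⟨y, hy, hya⟩ := Subring.mem_map.1 hza
      rw [hA, Subring.closure_le, Set.singleton_subset_iff]
      have hay : a - y ∈ Subring.closure ({b} ∪ {x | x ∈ A ∧ π x = 0}) :=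
        Subring.subset_closure (Or.inr ⟨sub_mem haA (hle hy), by rw [map_sub, hya, sub_self]⟩)
      have := add_mem (hle' hy) hay
      rwa [add_sub_cancel] at this

/-! ### Splitting off `ℤ[1/m]` -/

/-- If the powers of `u` lie in a finite set, then some positive power of `u` is idempotent. -/
theorem exists_pow_idempotent {M : Type*} [Monoid M] {u : M} {s : Set M} (hs : s.Finite)
    (hu : ∀ n, u ^ n ∈ s) : ∃ N, 0 < N ∧ u ^ N * u ^ N = u ^ N := by
  have := hs.to_subtype
  obtain ⟨i, j, hij, h⟩ :=
    Finite.exists_ne_map_eq_of_infinite fun n : ℕ => (⟨u ^ (n + 1), hu _⟩ : s)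
  replace h : u ^ (i + 1) = u ^ (j + 1) := congrArg Subtype.val h
  wlog hlt : i < j generalizing i j
  · exact this j i hij.symm h.symm (by omega)
  obtain ⟨d, rfl⟩ := Nat.exists_eq_add_of_lt hlt
  have hper (k : ℕ) : ∀ l, u ^ (i + 1 + l) = u ^ (i + 1 + l + k * (d + 1)) := by
    induction k with
    | zero => simp
    | succ k ih =>
      intro l
      have : u ^ (i + 1 + l) = u ^ (i + 1 + (l + (d + 1))) := by
        rw [pow_add, h, ← pow_add]
        congr 1
        omega
      rw [this, ih]
      congr 1
      ring
  -- From exponent `i + 1` on, powers have period `d + 1`; doubling this exponent adds `i + 1`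
  -- periods.
  refine ⟨(i + 1) * (d + 1), by positivity, ?_⟩
  rw [← pow_add]
  have := hper (i + 1) ((i + 1) * d)
  rw [show i + 1 + (i + 1) * d = (i + 1) * (d + 1) by ring] at this
  exact this.symm

/-- If `r₀` lifts `1/m`, all powers of `m • r₀` lie in the finite coset `1 + ker π`, so one is an
idempotent `f`. Then `r` inverts `m • f` in the corner ring of `f`. -/
theorem exists_idempotent_inverse {R : Type*} [Ring R] (π : R →+* ℚ)
    (hker : {x | π x = 0}.Finite) {m : ℕ} (hm : 0 < m) (hπ : 1 / (m : ℚ) ∈ π.range) :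
    ∃ f r : R, f * f = f ∧ f * r = r ∧ r * f = r ∧ m • r = f ∧ π f = 1 := by
  have hm' : (m : ℚ) ≠ 0 := by exact_mod_cast hm.ne'
  obtain ⟨r₀, hr₀⟩ := hπ
  have hone : π (m • r₀) = 1 := by
    rw [nsmul_eq_mul, map_mul, hr₀, map_natCast, mul_one_div_cancel hm']
  obtain ⟨N, hN, hid⟩ := exists_pow_idempotent (u := m • r₀) (hker.image (1 + ·)) fun n =>
    ⟨(m • r₀) ^ n - 1,
      by rw [Set.mem_ofPred_eq, map_sub, map_pow, hone, one_pow, map_one, sub_self],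
      add_sub_cancel _ _⟩
  obtain ⟨k, rfl⟩ := Nat.exists_eq_add_of_lt hN
  rw [zero_add] at hid
  have hc : Commute r₀ (m • r₀) := (Commute.refl r₀).smul_right m
  refine ⟨(m • r₀) ^ (k + 1), r₀ * (m • r₀) ^ k * (m • r₀) ^ (k + 1), hid, ?_, ?_, ?_, ?_⟩
  · have h1 : Commute r₀ ((m • r₀) ^ (k + 1)) := hc.pow_right _
    have h2 : Commute ((m • r₀) ^ k) ((m • r₀) ^ (k + 1)) := Commute.pow_pow_self _ _ _
    rw [← mul_assoc, ← (h1.mul_left h2).eq, mul_assoc, hid]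
  · rw [mul_assoc, hid]
  · rw [← smul_mul_assoc, ← smul_mul_assoc, ← pow_succ', hid]
  · rw [map_pow, hone, one_pow]

/-- A ring homomorphism to `ℚ` with finite kernel and image `ℤ[1/m]` admits a (nonunital)
multiplicative section over `ℤ[1/m]`. -/
theorem exists_section {R : Type*} [Ring R] (π : R →+* ℚ)
    (hker : {x | π x = 0}.Finite) {m : ℕ} (hm : 0 < m) (hπ : 1 / (m : ℚ) ∈ π.range) :
    ∃ s : ZInv m →ₙ+* R, ∀ z, π (s z) = z := by
  have hm' : (m : ℚ) ≠ 0 := by exact_mod_cast hm.ne'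
  obtain ⟨f, r, hff, hfr, hrf, hmr, hπf⟩ := exists_idempotent_inverse π hker hm hπ
  have hfpow (j : ℕ) : f * (f * r ^ j) = f * r ^ j := by rw [← mul_assoc, hff]
  have hcomm (j : ℕ) : f * r ^ j = r ^ j * f :=
    (Commute.pow_right (show Commute f r from hfr.trans hrf.symm) j).eq
  have hmul (i j : ℕ) : (f * r ^ i) * (f * r ^ j) = f * r ^ (i + j) := by
    rw [hcomm i, mul_assoc, hfpow, ← mul_assoc, ← hcomm i, mul_assoc, pow_add]
  have hred (i j : ℕ) : ((m : ℤ) ^ i) • (f * r ^ (i + j)) = f * r ^ j := by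
    induction i with
    | zero => simp
    | succ i ih =>
      have : (m : ℤ) • (f * r ^ (i + 1 + j)) = f * r ^ (i + j) := by
        rw [show i + 1 + j = (i + j) + 1 by ring, pow_succ', ← mul_assoc, hfr, natCast_zsmul,
          ← smul_mul_assoc, hmr]
      rw [pow_succ, mul_smul, this, ih]
  have hπr : π r = 1 / m := by
    have := congrArg π hmr
    rw [nsmul_eq_mul, map_mul, map_natCast, hπf] at this
    rw [eq_div_iff hm', mul_comm, this]
  -- `B` is the copy of `ℤ[1/m]` with identity `f`. As `π` is injective on it, the section is the
  -- inverse of `π` there.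
  let B : Set R := {x | ∃ (k : ℤ) (j : ℕ), x = k • (f * r ^ j)}
  have hπB (k : ℤ) (j : ℕ) : π (k • (f * r ^ j)) = k / (m : ℚ) ^ j := by
    rw [zsmul_eq_mul, map_mul, map_mul, map_pow, hπf, hπr, map_intCast, one_mul, one_div_pow,
      mul_one_div]
  have hadd {x y : R} (hx : x ∈ B) (hy : y ∈ B) : x + y ∈ B := by
    obtain ⟨k, i, rfl⟩ := hx
    obtain ⟨l, j, rfl⟩ := hy
    refine ⟨k * m ^ j + l * m ^ i, i + j, ?_⟩
    rw [add_smul, mul_smul, mul_smul, hred i j, add_comm i j, hred j i]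
  have hmulB {x y : R} (hx : x ∈ B) (hy : y ∈ B) : x * y ∈ B := by
    obtain ⟨k, i, rfl⟩ := hx
    obtain ⟨l, j, rfl⟩ := hy
    exact ⟨k * l, i + j, by rw [smul_mul_smul_comm, hmul]⟩
  have hneg {x : R} (hx : x ∈ B) : -x ∈ B := by
    obtain ⟨k, i, rfl⟩ := hx
    exact ⟨-k, i, by rw [neg_smul]⟩
  have hzero {x : R} (hx : x ∈ B) (h : π x = 0) : x = 0 := by
    obtain ⟨k, i, rfl⟩ := hx
    rw [hπB, div_eq_zero_iff] at h
    have : k = 0 := by exact_mod_cast h.resolve_right (pow_ne_zero _ hm')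
    rw [this, zero_smul]
  have hinj {x y : R} (hx : x ∈ B) (hy : y ∈ B) (h : π x = π y) : x = y :=
    sub_eq_zero.1 (hzero (sub_eq_add_neg x y ▸ hadd hx (hneg hy)) (by rw [map_sub, h, sub_self]))
  have hex (z : ZInv m) : ∃ x ∈ B, π x = z := by
    obtain ⟨k, j, hz⟩ := (mem_zInv_iff hm).1 z.2
    exact ⟨k • (f * r ^ j), ⟨k, j, rfl⟩, by rw [hπB, hz]⟩
  choose s hsB hs using hex
  refine ⟨{ toFun := s, map_mul' := fun z w => ?_, map_zero' := ?_, map_add' := fun z w => ?_ }, hs⟩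
  · exact hinj (hsB _) (hmulB (hsB _) (hsB _)) (by simp [hs])
  · exact hzero (hsB _) (by simp [hs])
  · exact hinj (hsB _) (hadd (hsB _) (hsB _)) (by simp [hs])

/-- The kernel of a ring homomorphism, as a nonunital subring. -/
def kerNonUnitalSubring {R S : Type*} [Ring R] [Ring S] (π : R →+* S) : NonUnitalSubring R where
  carrier := {x | π x = 0}
  zero_mem' := map_zero π
  add_mem' {x y} hx hy := by
    change π (x + y) = 0
    rw [map_add, show π x = 0 from hx, show π y = 0 from hy, add_zero]
  neg_mem' {x} hx := by
    change π (-x) = 0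
    rw [map_neg, show π x = 0 from hx, neg_zero]
  mul_mem' {x y} hx _ := by
    change π (x * y) = 0
    rw [map_mul, show π x = 0 from hx, zero_mul]

/-- The kernel of `π : R → S` is a two-sided `Z`-ring through any nonunital homomorphism
`Z → R`. -/
@[reducible]
def twoSidedRingKer {R S Z : Type*} [Ring R] [Ring S] [NonUnitalRing Z] (π : R →+* S)
    (s : Z →ₙ+* R) : TwoSidedRing Z (kerNonUnitalSubring π) where
  lsmul z x := ⟨s z * x, by
    change π (s z * x) = 0
    rw [map_mul, show π x = 0 from x.2, mul_zero]⟩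
  rsmul x z := ⟨x * s z, by
    change π (x * s z) = 0
    rw [map_mul, show π x = 0 from x.2, zero_mul]⟩
  lsmul_add z x y := Subtype.ext (mul_add _ _ _)
  add_lsmul z w x := Subtype.ext (by simp [add_mul])
  mul_lsmul z w x := Subtype.ext (by simp [mul_assoc])
  add_rsmul x y z := Subtype.ext (add_mul _ _ _)
  rsmul_add x z w := Subtype.ext (by simp [mul_add])
  rsmul_mul x z w := Subtype.ext (by simp [mul_assoc])
  lsmul_rsmul z x w := Subtype.ext (mul_assoc _ _ _)
  lsmul_mul_assoc z x y := Subtype.ext (mul_assoc _ _ _).symm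
  mul_lsmul_eq_rsmul_mul x z y := Subtype.ext (mul_assoc _ _ _).symm
  mul_rsmul_assoc x y z := Subtype.ext (mul_assoc _ _ _)

theorem isUnitalSemidirectZInv_of_ringHom {R : Type u} [Ring R] (π : R →+* ℚ)
    (hker : {x | π x = 0}.Finite) {m : ℕ} (hm : 0 < m) (hπ : ∀ z, z ∈ π.range ↔ z ∈ ZInv m) :
    IsUnitalSemidirectZInv R := by
  obtain ⟨s, hs⟩ := exists_section π hker hm ((hπ _).2 (Algebra.subset_adjoin rfl))
  let _ := twoSidedRingKer π s
  have hs1 : s 1 * s 1 = s 1 := by rw [← map_mul, one_mul]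
  refine ⟨m, hm, kerNonUnitalSubring π, inferInstance, inferInstance, hker.to_subtype, ?_, ?_⟩
  -- The section need not preserve `1`; the complementary idempotent lies in the kernel and measures
  -- the defect.
  · refine ⟨⟨1 - s 1, ?_⟩, Subtype.ext ?_, fun x => Subtype.ext ?_, fun x => Subtype.ext ?_⟩
    · change π (1 - s 1) = 0
      rw [map_sub, map_one, hs]
      simp
    · change (1 - s 1) * (1 - s 1) = 1 - s 1
      rw [mul_sub, sub_mul, sub_mul, hs1]
      simp
    · change s 1 * (x : R) = x - (1 - s 1) * x
      rw [sub_mul, one_mul, sub_sub_cancel]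
    · change (x : R) * s 1 = x - x * (1 - s 1)
      rw [mul_sub, mul_one, sub_sub_cancel]
  · let φ : RingSemidirect (ZInv m) (kerNonUnitalSubring π) →ₙ+* R :=
      { toFun := fun p => s p.fst + p.snd
        map_zero' := by
          change s 0 + 0 = 0
          rw [map_zero, add_zero]
        map_add' := fun p q => by
          change s (p.fst + q.fst) + (p.snd + q.snd : R) = _
          rw [map_add, add_add_add_comm]
        map_mul' := fun p q => by
          change s (p.fst * q.fst) + (s p.fst * q.snd + p.snd * s q.fst + p.snd * q.snd : R) = _
          rw [map_mul, add_mul, mul_add, mul_add]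
          abel }
    have hπφ (p) : π (φ p) = p.fst := by
      change π (s p.fst + p.snd) = _
      rw [map_add, hs, show π (p.snd : R) = 0 from p.snd.2, add_zero]
    have hbij : Function.Bijective φ := by
      constructor
      · intro p q hpq
        have h1 : p.fst = q.fst := Subtype.ext (by rw [← hπφ, hpq, hπφ])
        refine RingSemidirect.ext h1 (Subtype.ext ?_)
        have : s p.fst + (p.snd : R) = s q.fst + q.snd := hpq
        rw [h1] at this
        exact add_left_cancel this
      · intro x
        let z : ZInv m := ⟨π x, (hπ _).1 ⟨x, rfl⟩⟩
        refine ⟨⟨z, x - s z, ?_⟩, ?_⟩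
        · change π (x - s z) = 0
          rw [map_sub, hs, sub_self]
        · change s z + (x - s z) = x
          abel
    exact ⟨(RingEquiv.ofBijective φ hbij).symm⟩

/-! ### The two implications and the cardinality count -/

theorem isUnitalSemidirectZInv_of_finite {R : Type u} [Ring R] [Infinite R]
    (H : (Set.range fun a : R => Subring.closure {a}).Finite) : IsUnitalSemidirectZInv R := by
  have := charZero_of_finite_range_closure H
  obtain ⟨π, hπ⟩ := exists_ringHom_rat H
  obtain ⟨m, hm, hrange⟩ := exists_range_eq_zInv H π
  exact isUnitalSemidirectZInv_of_ringHom π ((finite_torsion H).subset hπ) hm hrange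

theorem IsUnitalSemidirectZInv.finite_range_closure {R : Type u} [Ring R]
    (h : IsUnitalSemidirectZInv R) : (Set.range fun a : R => Subring.closure {a}).Finite := by
  obtain ⟨m, hm, I, _, _, _, -, ⟨φ⟩⟩ := h
  let π : R →+* ℚ :=
    { toFun := fun x => ((φ x).fst : ℚ)
      map_zero' := by
        rw [map_zero]
        rfl
      map_add' := fun x y => by
        rw [map_add]
        rfl
      map_mul' := fun x y => by
        rw [map_mul]
        rfl
      map_one' := by
        -- `φ 1` is a left identity; multiplying `⟨1, 0⟩` by it reveals its first component.
        have h1 : φ 1 * ⟨1, 0⟩ = ⟨1, 0⟩ := by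
          obtain ⟨x, hx⟩ := φ.surjective ⟨1, 0⟩
          rw [← hx, ← map_mul, one_mul]
        have h2 : (φ 1).fst * 1 = 1 := congrArg RingSemidirect.fst h1
        rw [mul_one] at h2
        rw [h2]
        rfl }
  refine finite_range_closure_of_ringHom π ?_ hm fun x => (φ x).fst.2
  refine Set.Finite.of_finite_image (f := fun x => (φ x).snd) (Set.toFinite _) ?_
  intro x hx y hy hxy
  have hx' : ((φ x).fst : ℚ) = 0 := hx
  have hy' : ((φ y).fst : ℚ) = 0 := hy
  exact φ.injective (RingSemidirect.ext (Subtype.ext (hx'.trans hy'.symm)) hxy)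

theorem IsUnitalSemidirectZInv.countable {R : Type u} [Ring R]
    (h : IsUnitalSemidirectZInv R) : Countable R := by
  obtain ⟨m, -, I, _, _, _, -, ⟨φ⟩⟩ := h
  refine Function.Injective.countable (f := fun x => ((φ x).fst, (φ x).snd)) fun x y hxy => ?_
  exact φ.injective (RingSemidirect.ext (congrArg Prod.fst hxy) (congrArg Prod.snd hxy))

theorem countable_closure_singleton {R : Type*} [Ring R] (a : R) :
    (Subring.closure {a} : Set R).Countable := by
  have : Countable (Polynomial ℤ) :=
    Cardinal.mk_le_aleph0_iff.1 (Polynomial.cardinalMk_le_max.trans (by simp))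
  refine (Set.countable_range fun p : Polynomial ℤ => Polynomial.aeval a p).mono fun x hx => ?_
  exact mem_closure_singleton_iff_aeval.1 hx

/-- The class of `a` lies in the countable subring generated by `a`, so `R` has at most `ℵ₀`
elements per vertex. -/
theorem mk_vertices_eq {R : Type u} [Ring R] (h : Infinite (unitalCompressedCommutingGraph R).V) :
    Cardinal.mk (unitalCompressedCommutingGraph R).V = Cardinal.mk R := by
  let q : R → (unitalCompressedCommutingGraph R).V := Quotient.mk (unitalSetoid R)
  refine le_antisymm (Cardinal.mk_le_of_surjective (f := q) Quotient.mk_surjective) ?_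
  refine (Cardinal.mk_le_mk_mul_of_mk_preimage_le (c := Cardinal.aleph0) q fun v => ?_).trans ?_
  · obtain ⟨a, rfl⟩ := Quotient.mk_surjective v
    refine Cardinal.mk_le_aleph0_iff.2
      (Set.Countable.to_subtype ((countable_closure_singleton a).mono fun b hb => ?_))
    have : Subring.closure {b} = Subring.closure {a} := Quotient.exact hb
    change b ∈ Subring.closure {a}
    rw [← this]
    exact Subring.subset_closure rfl
  · exact (Cardinal.mul_aleph0_eq (Cardinal.aleph0_le_mk _)).le

theorem theorem5p4 (R : Type u) [Ring R] [Infinite R] :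
    (Cardinal.mk (unitalCompressedCommutingGraph R).V = Cardinal.mk R ∨
      IsUnitalSemidirectZInv R) ∧
    (IsUnitalSemidirectZInv R →
      Cardinal.mk R = Cardinal.aleph0 ∧ Finite (unitalCompressedCommutingGraph R).V) := by
  refine ⟨?_, fun h => ⟨?_, (finite_vertices_iff R).2 h.finite_range_closure⟩⟩
  · rcases finite_or_infinite (unitalCompressedCommutingGraph R).V with h | h
    · exact Or.inr (isUnitalSemidirectZInv_of_finite ((finite_vertices_iff R).1 h))
    · exact Or.inl (mk_vertices_eq h)
  · have := h.countable
    exact Cardinal.mk_eq_aleph0 R
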